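/- Let $L\ge 1$ and $\mathcal U=[0,1]^{L-1}\times\{1\}\subset\mathbb R^L$. Fix a constant sampling interval $\Delta>0$. Definition (B$_2$S$_6$ unit with sampling interval $\Delta$). Let $h,p,n\ge1$ and $d=hp$, and write vectors of $\mathbb R^d$ as stacks $\mathbf v=({}^1\mathbf v^\top,\dots,{}^h\mathbf v^\top)^\top$ of $h$ blocks ${}^j\mathbf v\in\mathbb R^p$. The parameters are an invertible diagonal matrix $\mathbf A\in\mathbb R^{n\times n}$ and, for $1\le j\le h$ and $1\le i\le p$, ${}^j\mathbf B_{\rm weight}\in\mathbb R^{n\times p}$, ${}^j\mathbf B^{(i)}_{\rm bias}\in\mathbb R^{n}$ and ${}^j\mathbf C\in\mathbb R^{p\times n}$. For an input sequence $\mathbf u_1,\dots,\mathbf u_L\in\mathbb R^d$, the unit $\Gamma$ returns the sequence $\mathbf y_1,\dots,\mathbf y_L\in\mathbb R^d$ given, with ${}^j\mathbf x^{(i)}_0=\mathbf 0\in\mathbb R^n$ and for $1\le k\le L$, by $${}^j\mathbf x^{(i)}_k=e^{\Delta\mathbf A}\,{}^j\mathbf x^{(i)}_{k-1}+\mathbf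 A^{-1}\bigl(e^{\Delta\mathbf A}-\mathbf I\bigr)\bigl({}^j\mathbf B_{\rm weight}\,{}^j\mathbf u_k+{}^j\mathbf B^{(i)}_{\rm bias}\bigr)\,{}^j\mathbf u^{(i)}_k,\qquad {}^j\mathbf y^{(i)}_k={}^j\mathbf u_k^\top\,{}^j\mathbf C\;{}^j\mathbf x^{(i)}_k .$$ Given $\mathbf M,\mathbf N,\boldsymbol\theta\in\mathbb R^d$ and $\sigma:\mathbb R\to\mathbb R$ (applied entrywise), the single-layer model is $$\tilde G(u_1,\dots,u_L)=\mathbf N^\top\sigma\bigl(\Gamma(u_1\mathbf M,\dots,u_L\mathbf M)_L+\boldsymbol\theta\bigr).$$ Theorem. Let $\sigma:\mathbb R\to\mathbb R$ be Lipschitz continuous and not a polynomial, let $G:\mathcal U\to\mathbb R$ be continuous, and let $\epsilon>0$. Then: 1. (Block structure alone.) There exist $h,p,n\ge1$, vectors $\mathbf M,\mathbf N,\boldsymbol\theta\in\mathbb R^{hp}$ and parameters $\mathbf A$, ${}^j\mathbf B_{\rm weight}$, ${}^j\mathbf C$ such that, with ${}^j\mathbf B^{(i)}_{\rm bias}=\mathbf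 0$ for all $i,j$, $|\tilde G(\mathbf u)-G(\mathbf u)|\le\epsilon$ for all $\mathbf u\in\mathcal U$. 2. (Bias alone.) There exist $d,n\ge1$, vectors $\mathbf M,\mathbf N,\boldsymbol\theta\in\mathbb R^{d}$ and parameters $\mathbf A$, ${}^1\mathbf B_{\rm weight}$, ${}^1\mathbf B^{(i)}_{\rm bias}$, ${}^1\mathbf C$ ($1\le i\le d$) of a unit with a single block, $h=1$ and $p=d$, such that $|\tilde G(\mathbf u)-G(\mathbf u)|\le\epsilon$ for all $\mathbf u\in\mathcal U$. -/

import Mathlib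

namespace B2S6

open Matrix

/-- The `j`-th sub-vector of size `p` of a vector in `ℝ^d`, `d = h * p`: the entries with
(zero-based) indices `j * p, …, j * p + (p - 1)`. -/
def block {h p : ℕ} (v : Fin (h * p) → ℝ) (j : Fin h) : Fin p → ℝ :=
  fun i => v (finProdFinEquiv (j, i))

/-- The vector in `ℝ^d`, `d = h * p`, obtained by stacking `h` sub-vectors of size `p`. -/
def stack {h p : ℕ} (y : Fin h → Fin p → ℝ) : Fin (h * p) → ℝ :=
  fun c => y (finProdFinEquiv.symm c).1 (finProdFinEquiv.symm c).2

/-- The trainable parameters of a block-biased selective state space unit with `h` blocks of size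
`p` and state dimension `n`, apart from those that produce the sampling intervals. -/
structure Params (h p n : ℕ) where
  /-- The state matrix, shared by all blocks and channels. -/
  A : Matrix (Fin n) (Fin n) ℝ
  /-- The input weights of each block. -/
  Bweight : Fin h → Matrix (Fin n) (Fin p) ℝ
  /-- The input-independent bias of each channel `i` of each block `j`. -/
  Bbias : Fin h → Fin p → (Fin n → ℝ)
  /-- The output weights of each block. -/
  C : Fin h → Matrix (Fin p) (Fin n) ℝ

namespace Params

variable {h p n : ℕ}

/-- Zero-order hold state matrix `exp (δ A)` for the sampling interval `δ`. -/
noncomputable def Abar (P : Params h p n) (δ : ℝ) : Matrix (Fin n) (Fin n) ℝ :=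
  NormedSpace.exp (δ • P.A)

/-- Zero-order hold input vector `A⁻¹ (exp (δ A) - I) (Bweight_j v + Bbias_j^(i))` of channel `i` of
block `j`, where `δ` is the sampling interval and `v` is the current input of block `j`. -/
noncomputable def Bbar (P : Params h p n) (δ : ℝ) (j : Fin h) (i : Fin p) (v : Fin p → ℝ) :
    Fin n → ℝ :=
  (P.A⁻¹ * (P.Abar δ - 1)) *ᵥ (P.Bweight j *ᵥ v + P.Bbias j i)

/-- The output row vector `vᵀ C_j` of block `j`, where `v` is the current input of block `j`. -/
def Cbar (P : Params h p n) (j : Fin h) (v : Fin p → ℝ) : Fin n → ℝ :=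
  v ᵥ* P.C j

/-- The hidden state of channel `i` of block `j` after `k` steps, started from `0`. The array `Δ`
contains the sampling intervals (time step, block, channel). The `(k+1)`-st input vector is `u k`,
as indices in `Fin L` start at `0`. -/
noncomputable def state (P : Params h p n) {L : ℕ} (Δ : Fin L → Fin h → Fin p → ℝ)
    (u : Fin L → Fin (h * p) → ℝ) (j : Fin h) (i : Fin p) : (k : ℕ) → k ≤ L → (Fin n → ℝ)
  | 0, _ => 0
  | k + 1, hk =>
      P.Abar (Δ ⟨k, hk⟩ j i) *ᵥ P.state Δ u j i k (Nat.le_of_succ_le hk) +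
        block (u ⟨k, hk⟩) j i • P.Bbar (Δ ⟨k, hk⟩ j i) j i (block (u ⟨k, hk⟩) j)

/-- The unit as a map from sequences of length `L` in `ℝ^d` to such sequences, `d = h * p`. -/
noncomputable def unit (P : Params h p n) {L : ℕ} (Δ : Fin L → Fin h → Fin p → ℝ)
    (u : Fin L → Fin (h * p) → ℝ) : Fin L → Fin (h * p) → ℝ :=
  fun k => stack fun j i => P.Cbar j (block (u k) j) ⬝ᵥ P.state Δ u j i (k + 1) k.isLt

end Params

/-- The last position of a nonempty sequence. -/
def lastPos {L : ℕ} (hL : 1 ≤ L) : Fin L := ⟨L - 1, Nat.sub_lt hL Nat.one_pos⟩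

/-- The single-layer model `u ↦ N σ(Γ(M u₁, …, M u_L)_L + θ)` with encoder `M`, decoder `N`,
bias `θ`, activation `σ` (applied entrywise) and sequence-to-sequence unit `Γ`. -/
def singleLayer {L d : ℕ} (hL : 1 ≤ L) (σ : ℝ → ℝ)
    (Γ : (Fin L → Fin d → ℝ) → (Fin L → Fin d → ℝ)) (M N θ : Fin d → ℝ) (u : Fin L → ℝ) : ℝ :=
  ∑ c, N c * σ (Γ (fun k => u k • M) (lastPos hL) c + θ c)

/-- The set `[0,1]^(L-1) × {1}`. -/
def inputs {L : ℕ} (hL : 1 ≤ L) : Set (Fin L → ℝ) :=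
  {u | (∀ k, u k ∈ Set.Icc (0 : ℝ) 1) ∧ u (lastPos hL) = 1}

end B2S6

/-! Since `u_L = 1`, the output gating can be made trivial at the last position. With a
one-dimensional block the state is driven by `u_k ^ 2`, with bias alone by `u_k`. Distinct
eigenvalues make the impulse responses a Vandermonde system, so each output entry realizes any `∑
w_k Φ(u)_k`, where `Φ` is coordinatewise squaring (injective on `[0,1]^L`) or the identity. It
remains to show that ridge functions of `σ` are dense. A closed space containing all `σ (w g + θ)`
contains every `g ^ k`, by finite differences in place of derivatives; hence it contains `exp g`,
and Stone–Weierstrass applies. -/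

/-! ### Continuous functions with vanishing iterated differences -/

/-- Newton's formula makes `f` a polynomial of degree below `k` on each lattice `-N + ℕ / m`. Every
such lattice contains `0, …, k - 1`, so all these polynomials are the interpolant `q` at those
nodes. Rationals are dense. -/
theorem exists_polynomial_of_fwdDiff_iter_eq_zero {f : ℝ → ℝ} (hf : Continuous f) {k : ℕ}
    (h0 : ∀ h x : ℝ, ((fwdDiff h)^[k] f) x = 0) : ∃ q : Polynomial ℝ, ∀ x, f x = q.eval x := by
  obtain ⟨q, hqdeg, hqeval⟩ : ∃ q : Polynomial ℝ, q.degree < k ∧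
      ∀ i < k, q.eval (i : ℝ) = f i := by
    have hinj : Set.InjOn (fun i : ℕ => (i : ℝ)) (Finset.range k : Set ℕ) :=
      Nat.cast_injective.injOn
    refine ⟨Lagrange.interpolate (Finset.range k) (fun i : ℕ => (i : ℝ)) (fun i => f i), ?_,
      fun i hi => Lagrange.eval_interpolate_at_node (fun i : ℕ => f i) hinj
        (Finset.mem_range.2 hi)⟩
    exact (Lagrange.degree_interpolate_lt (fun i : ℕ => f i) hinj).trans_eq
      (by rw [Finset.card_range])
  have hz : ∀ (h x : ℝ) (i : ℕ), k ≤ i → ((fwdDiff h)^[i] f) x = 0 := by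
    intro h x i hi
    obtain ⟨j, rfl⟩ := Nat.exists_eq_add_of_le' hi
    have hk : (fwdDiff h)^[k] f = 0 := funext fun x => h0 h x
    have hj : (fwdDiff h)^[j] (0 : ℝ → ℝ) = 0 := Function.iterate_fixed (by ext; simp [fwdDiff]) j
    rw [Function.iterate_add_apply, hk, hj, Pi.zero_apply]
  have key : ∀ (N m n : ℕ), 0 < m → f (-N + n * (1 / m : ℝ)) = q.eval (-N + n * (1 / m : ℝ)) := by
    intro N m n hm
    have hm' : (m : ℝ) ≠ 0 := by positivity
    let p : Polynomial ℝ := ∑ i ∈ Finset.range k,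
      Polynomial.C (((fwdDiff (1 / m : ℝ))^[i] f) (-N) / i.factorial) * descPochhammer ℝ i
    have hpeval : ∀ n : ℕ, p.eval (n : ℝ) = f (-N + n * (1 / m : ℝ)) := by
      intro n
      have h1 := shift_eq_sum_fwdDiff_iter (1 / m : ℝ) f n (-N)
      rw [nsmul_eq_mul] at h1
      rw [h1, Polynomial.eval_finsetSum]
      have hterm : ∀ i, (Polynomial.C (((fwdDiff (1 / m : ℝ))^[i] f) (-N) / i.factorial) *
          descPochhammer ℝ i).eval (n : ℝ) = n.choose i • ((fwdDiff (1 / m : ℝ))^[i] f) (-N) := by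
        intro i
        rw [Polynomial.eval_mul, Polynomial.eval_C, descPochhammer_eval_eq_descFactorial,
          Nat.descFactorial_eq_factorial_mul_choose, nsmul_eq_mul]
        push_cast
        field_simp
      rw [Finset.sum_congr rfl fun i _ => hterm i]
      -- Terms from `k` on vanish by `hz`, terms beyond `n` by the binomial coefficient.
      refine (Finset.sum_subset (Finset.range_subset_range.2 (le_max_left k (n + 1))) ?_).trans
        (Finset.sum_subset (Finset.range_subset_range.2 (le_max_right k (n + 1))) ?_).symm
      · intro i _ hi
        rw [hz _ _ _ (by simpa using hi), smul_zero]
      · intro i _ hi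
        rw [Nat.choose_eq_zero_of_lt (by simpa using hi), zero_smul]
    let r : Polynomial ℝ := q.comp (Polynomial.C (-N : ℝ) + Polynomial.C (1 / m : ℝ) * Polynomial.X)
    have hreval : ∀ x : ℝ, r.eval x = q.eval (-N + x * (1 / m : ℝ)) := by
      intro x
      rw [Polynomial.eval_comp, Polynomial.eval_add, Polynomial.eval_mul, Polynomial.eval_C,
        Polynomial.eval_C, Polynomial.eval_X, mul_comm x]
    have hpr : p = r := by
      -- The index `m * (N + i)` is where the lattice meets the node `i`.
      refine Polynomial.eq_of_degrees_lt_of_eval_finset_eq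
        ((Finset.range k).image fun i => ((m * (N + i) : ℕ) : ℝ)) ?_ ?_ ?_
      all_goals try rw [Finset.card_image_of_injective _ (fun a b hab => by
        have := Nat.cast_injective (R := ℝ) hab
        have := Nat.eq_of_mul_eq_mul_left hm this
        omega), Finset.card_range]
      · refine (Polynomial.degree_sum_le _ _).trans_lt ?_
        refine (Finset.sup_lt_iff (WithBot.bot_lt_coe k)).2 ?_
        intro i hi
        refine Polynomial.degree_le_natDegree.trans_lt (Nat.cast_lt.2 ?_)
        refine (Polynomial.natDegree_C_mul_le _ _).trans_lt ?_
        rw [descPochhammer_natDegree]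
        exact Finset.mem_range.1 hi
      · by_cases hq0 : q = 0
        · simp [r, hq0]
        refine Polynomial.degree_le_natDegree.trans_lt ?_
        have hl : (Polynomial.C (-N : ℝ) + Polynomial.C (1 / m : ℝ) * Polynomial.X).natDegree ≤ 1 := by
          compute_degree
        have h2 : r.natDegree ≤ q.natDegree := by
          refine Polynomial.natDegree_comp_le.trans ?_
          exact (Nat.mul_le_mul_left _ hl).trans (by simp)
        refine lt_of_le_of_lt (Nat.cast_le.2 h2) ?_
        rwa [← Polynomial.degree_eq_natDegree hq0]
      · intro x hx
        obtain ⟨i, hi, rfl⟩ := Finset.mem_image.1 hx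
        have e : (-N + ((m * (N + i) : ℕ) : ℝ) * (1 / m : ℝ)) = i := by
          push_cast; field_simp; ring
        rw [hpeval, hreval, e, hqeval i (Finset.mem_range.1 hi)]
    rw [← hpeval, hpr, hreval]
  refine ⟨q, fun x => ?_⟩
  refine congrFun (Rat.denseRange_cast.equalizer hf q.continuous (funext fun a => ?_)) x
  have h3 := key a.num.natAbs a.den (a.num + a.num.natAbs * a.den).toNat a.den_pos
  have hnn : 0 ≤ a.num + a.num.natAbs * a.den := by
    have h4 : (1 : ℤ) ≤ a.den := by exact_mod_cast a.den_pos
    have h5 : (0 : ℤ) ≤ a.num.natAbs := by positivity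
    have : -a.num ≤ a.num.natAbs := by omega
    nlinarith
  have h6 : (((a.num + a.num.natAbs * a.den).toNat : ℕ) : ℝ) =
      a.num + (a.num.natAbs : ℝ) * a.den := by
    rw [← Int.cast_natCast (R := ℝ) (Int.toNat _), Int.toNat_of_nonneg hnn, Int.cast_add,
      Int.cast_mul, Int.cast_natCast, Int.cast_natCast]
  have hd : (a.den : ℝ) ≠ 0 := by exact_mod_cast a.den_nz
  have h7 : (-(a.num.natAbs : ℝ) + (((a.num + a.num.natAbs * a.den).toNat : ℕ) : ℝ) *
      (1 / (a.den : ℝ))) = (a : ℝ) := by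
    rw [h6, Rat.cast_def]
    field_simp
    ring
  rw [h7] at h3
  exact h3

/-! ### Density of ridge functions -/

open intervalIntegral in
theorem LipschitzWith.abs_integral_sub_mul_le {K : NNReal} {f : ℝ → ℝ} (hf : LipschitzWith K f)
    (b s : ℝ) : |(∫ r in b..b + s, f r) - s * f b| ≤ K * s ^ 2 := by
  have h1 : (∫ r in b..b + s, f r) - s * f b = ∫ r in b..b + s, (f r - f b) := by
    rw [integral_sub (hf.continuous.intervalIntegrable _ _) intervalIntegrable_const]
    simp
  rw [h1, ← Real.norm_eq_abs]
  refine (norm_integral_le_of_norm_le_const (C := K * |s|) fun x hx => ?_).trans_eq ?_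
  · refine (hf.norm_sub_le x b).trans (mul_le_mul_of_nonneg_left ?_ K.2)
    rw [Real.norm_eq_abs]
    have h2 := Set.abs_sub_left_of_mem_uIcc (Set.uIoc_subset_uIcc hx)
    simpa using h2
  · rw [add_sub_cancel_left, mul_assoc, abs_mul_abs_self, sq]

section

variable {X : Type*} [TopologicalSpace X] [CompactSpace X]

/-- `V` is complete, so the integral of a continuous curve in `V` can be formed inside `V`. -/
theorem ContinuousMap.mul_integral_mem {V : Submodule ℝ C(X, ℝ)} (hV : IsClosed (V : Set C(X, ℝ)))
    {f : ℝ → ℝ} (hf : Continuous f) (φ ψ : C(X, ℝ))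
    (hmem : ∀ (s : ℝ) (χ : C(X, ℝ)), (∀ x, χ x = φ x * f (ψ x + s)) → χ ∈ V)
    (h : ℝ) (χ : C(X, ℝ)) (hχ : ∀ x, χ x = φ x * ∫ r in ψ x..ψ x + h, f r) : χ ∈ V := by
  let c : ℝ → C(X, ℝ) := fun s => ⟨fun x => φ x * f (ψ x + s), by fun_prop⟩
  have hc : Continuous c := by
    refine ContinuousMap.continuous_of_continuous_uncurry _ ?_
    change Continuous fun z : ℝ × X => φ z.2 * f (ψ z.2 + z.1)
    fun_prop
  let c' : ℝ → V := fun s => ⟨c s, hmem s _ fun _ => rfl⟩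
  have hc' : Continuous c' := hc.subtype_mk _
  have : CompleteSpace V := hV.completeSpace_coe
  have h1 : ((∫ s in (0 : ℝ)..h, c' s : V) : C(X, ℝ)) = ∫ s in (0 : ℝ)..h, c s :=
    (ContinuousLinearMap.intervalIntegral_comp_comm (𝕜 := ℝ) V.subtypeL
      (hc'.intervalIntegrable (μ := MeasureTheory.volume) 0 h)).symm
  have h2 : χ = ∫ s in (0 : ℝ)..h, c s := by
    ext x
    have h3 := (ContinuousMap.evalCLM ℝ x).intervalIntegral_comp_comm
      (hc.intervalIntegrable 0 h (μ := MeasureTheory.volume))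
    change _ = (ContinuousMap.evalCLM ℝ x) (∫ s in (0 : ℝ)..h, c s)
    rw [← h3, hχ]
    change _ = ∫ s in (0 : ℝ)..h, φ x * f (ψ x + s)
    rw [intervalIntegral.integral_const_mul, intervalIntegral.integral_comp_add_left f (ψ x),
      add_zero]
  rw [h2, ← h1]
  exact Subtype.prop _

/-- Averaging over a window of length `h` gains one derivative: the target is the derivative at `v =
w` of `φ ∫ f` over `[v g + θ, v g + θ + h]`. The Lipschitz bound makes the difference quotients
converge uniformly. -/
theorem ContinuousMap.mul_fwdDiff_mem {V : Submodule ℝ C(X, ℝ)} (hV : IsClosed (V : Set C(X, ℝ)))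
    {K : NNReal} {f : ℝ → ℝ} (hf : LipschitzWith K f) (φ g : C(X, ℝ))
    (hmem : ∀ (w θ : ℝ) (χ : C(X, ℝ)), (∀ x, χ x = φ x * f (w * g x + θ)) → χ ∈ V)
    (h w θ : ℝ) (χ : C(X, ℝ)) (hχ : ∀ x, χ x = φ x * g x * (fwdDiff h f) (w * g x + θ)) : χ ∈ V := by
  have hfc := hf.continuous
  have hcont : Continuous fun z : ℝ × ℝ => ∫ r in z.1..z.2, f r := by
    have e : (fun z : ℝ × ℝ => ∫ r in z.1..z.2, f r) =
        fun z : ℝ × ℝ => (∫ r in (0 : ℝ)..z.2, f r) - ∫ r in (0 : ℝ)..z.1, f r := by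
      funext z
      exact (intervalIntegral.integral_interval_sub_left (hfc.intervalIntegrable _ _)
        (hfc.intervalIntegrable _ _)).symm
    rw [e]
    have hp : Continuous fun t : ℝ => ∫ r in (0 : ℝ)..t, f r :=
      intervalIntegral.continuous_primitive (fun a b => hfc.intervalIntegrable a b) 0
    exact (hp.comp continuous_snd).sub (hp.comp continuous_fst)
  let I : ℝ → C(X, ℝ) := fun v =>
    ⟨fun x => φ x * ∫ r in v * g x + θ..v * g x + θ + h, f r, φ.continuous.mul
      (hcont.comp (f := fun x => (v * g x + θ, v * g x + θ + h)) (by fun_prop))⟩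
  have hI : ∀ v, I v ∈ V := fun v =>
    mul_integral_mem hV hfc φ ⟨fun x => v * g x + θ, by fun_prop⟩
      (fun s χ hs => hmem v (θ + s) χ fun x =>
        (hs x).trans (congrArg (fun t => φ x * f t) (add_assoc _ _ _)))
      h _ fun _ => rfl
  have hbound : ∀ δ : ℝ, 0 < δ →
      ‖δ⁻¹ • (I (w + δ) - I w) - χ‖ ≤ δ * (‖φ‖ * (2 * K * ‖g‖ ^ 2)) := by
    intro δ hδ
    refine (ContinuousMap.norm_le _ (by positivity)).2 fun x => ?_
    set b := w * g x + θ with hb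
    have e1 : (w + δ) * g x + θ = b + δ * g x := by rw [hb]; ring
    have hi := fun p q : ℝ => hfc.intervalIntegrable (μ := MeasureTheory.volume) p q
    -- Shifting the window changes the integral only by its two short ends.
    have e2 : (∫ r in b + δ * g x..b + δ * g x + h, f r) - (∫ r in b..b + h, f r) =
        (∫ r in b + h..b + h + δ * g x, f r) - ∫ r in b..b + δ * g x, f r := by
      have e3 := intervalIntegral.integral_add_adjacent_intervals (hi b (b + δ * g x))
        (hi (b + δ * g x) (b + δ * g x + h))
      have e4 := intervalIntegral.integral_add_adjacent_intervals (hi b (b + h))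
        (hi (b + h) (b + h + δ * g x))
      rw [add_right_comm b h] at e4 ⊢
      linarith
    have e5 : (δ⁻¹ • (I (w + δ) - I w) - χ) x = δ⁻¹ * φ x *
        (((∫ r in b + h..b + h + δ * g x, f r) - δ * g x * f (b + h)) -
          ((∫ r in b..b + δ * g x, f r) - δ * g x * f b)) := by
      have e6 : (δ⁻¹ • (I (w + δ) - I w) - χ) x =
          δ⁻¹ * (φ x * (∫ r in (w + δ) * g x + θ..(w + δ) * g x + θ + h, f r) -
            φ x * ∫ r in b..b + h, f r) - χ x := rfl
      rw [e6, hχ, e1, ← mul_sub, e2, fwdDiff, ← hb]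
      field_simp
      ring
    have hφ := φ.norm_coe_le_norm x
    have hg := g.norm_coe_le_norm x
    have b1 := hf.abs_integral_sub_mul_le (b + h) (δ * g x)
    have b2 := hf.abs_integral_sub_mul_le b (δ * g x)
    have b3 : K * (δ * g x) ^ 2 ≤ K * (δ ^ 2 * ‖g‖ ^ 2) := by
      rw [mul_pow]
      have : g x ^ 2 ≤ ‖g‖ ^ 2 := by
        rw [← sq_abs, ← Real.norm_eq_abs]; gcongr
      gcongr
    rw [e5, norm_mul, norm_mul, norm_inv, Real.norm_of_nonneg hδ.le]
    calc δ⁻¹ * ‖φ x‖ * ‖_ - _‖ ≤ δ⁻¹ * ‖φ‖ * (K * (δ ^ 2 * ‖g‖ ^ 2) + K * (δ ^ 2 * ‖g‖ ^ 2)) := by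
          gcongr
          exact (norm_sub_le _ _).trans (add_le_add (b1.trans b3) (b2.trans b3))
      _ = δ * (‖φ‖ * (2 * K * ‖g‖ ^ 2)) := by field_simp; ring
  have hlim : Filter.Tendsto (fun n : ℕ => (1 / ((n : ℝ) + 1))⁻¹ • (I (w + 1 / ((n : ℝ) + 1)) - I w))
      Filter.atTop (nhds χ) := by
    rw [tendsto_iff_norm_sub_tendsto_zero]
    refine squeeze_zero (fun _ => norm_nonneg _) (fun n => hbound _ Nat.one_div_pos_of_nat) ?_
    simpa using (tendsto_one_div_add_atTop_nhds_zero_nat (𝕜 := ℝ)).mul_const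
      (‖φ‖ * (2 * K * ‖g‖ ^ 2))
  exact hV.mem_of_tendsto hlim (Filter.Eventually.of_forall fun n =>
    V.smul_mem _ (V.sub_mem (hI _) (hI _)))

/-- Each difference of `σ` brings out a factor `g`. At `w = 0` the remaining factor is a constant,
nonzero for some step and base point because `σ` is not a polynomial. -/
theorem ContinuousMap.pow_mem_of_comp_affine_mem {V : Submodule ℝ C(X, ℝ)}
    (hV : IsClosed (V : Set C(X, ℝ))) {K : NNReal} {σ : ℝ → ℝ} (hσ : LipschitzWith K σ)
    (hσ' : ¬ ∃ q : Polynomial ℝ, ∀ x, σ x = q.eval x) (g : C(X, ℝ))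
    (hmem : ∀ (w θ : ℝ) (χ : C(X, ℝ)), (∀ x, χ x = σ (w * g x + θ)) → χ ∈ V) (k : ℕ) :
    g ^ k ∈ V := by
  have key : ∀ (h : ℝ) (k : ℕ), (∃ K', LipschitzWith K' ((fwdDiff h)^[k] σ)) ∧
      ∀ (w θ : ℝ) (χ : C(X, ℝ)), (∀ x, χ x = (g ^ k) x * ((fwdDiff h)^[k] σ) (w * g x + θ)) → χ ∈ V := by
    intro h k
    induction k with
    | zero => exact ⟨⟨K, hσ⟩, fun w θ χ hχ => hmem w θ χ fun x => by simpa using hχ x⟩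
    | succ k ih =>
      obtain ⟨⟨K', hK'⟩, ih⟩ := ih
      rw [Function.iterate_succ_apply']
      refine ⟨⟨_, (hK'.comp (LipschitzWith.id.add (LipschitzWith.const h))).sub hK'⟩,
        fun w θ χ hχ => mul_fwdDiff_mem hV hK' (g ^ k) g ih h w θ χ fun x => ?_⟩
      rw [hχ, pow_succ, ContinuousMap.mul_apply]
  obtain ⟨h, b, hb⟩ : ∃ h b : ℝ, ((fwdDiff h)^[k] σ) b ≠ 0 := by
    by_contra! hcon
    exact hσ' (exists_polynomial_of_fwdDiff_iter_eq_zero hσ.continuous hcon)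
  rw [← V.smul_mem_iff hb]
  refine (key h k).2 0 b _ fun x => ?_
  rw [ContinuousMap.smul_apply, smul_eq_mul, mul_comm, zero_mul, zero_add]

/-- Universal approximation: the ridge functions of a Lipschitz, non-polynomial activation with
respect to a point-separating space of functions are dense. -/
theorem ContinuousMap.eq_top_of_ridge_mem {V : Submodule ℝ C(X, ℝ)}
    (hV : IsClosed (V : Set C(X, ℝ))) {K : NNReal} {σ : ℝ → ℝ} (hσ : LipschitzWith K σ)
    (hσ' : ¬ ∃ q : Polynomial ℝ, ∀ x, σ x = q.eval x) (E : Submodule ℝ C(X, ℝ))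
    (hE : ∀ x y : X, x ≠ y → ∃ g ∈ E, g x ≠ g y)
    (hmem : ∀ g ∈ E, ∀ (θ : ℝ) (χ : C(X, ℝ)), (∀ x, χ x = σ (g x + θ)) → χ ∈ V) : V = ⊤ := by
  have hexp : ∀ g ∈ E, NormedSpace.exp g ∈ V := by
    intro g hg
    have hs := NormedSpace.exp_series_hasSum_exp' (𝕂 := ℝ) g
    refine hV.mem_of_tendsto hs (Filter.Eventually.of_forall fun s => V.sum_mem fun k _ =>
      V.smul_mem _ (pow_mem_of_comp_affine_mem hV hσ hσ' g (fun w θ χ hχ => ?_) k))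
    exact hmem (w • g) (E.smul_mem w hg) θ χ hχ
  -- Exponentials of `E` are closed under products, so their linear span is already an algebra.
  let S : Submonoid C(X, ℝ) :=
    { carrier := NormedSpace.exp '' (E : Set C(X, ℝ))
      one_mem' := ⟨0, E.zero_mem, NormedSpace.exp_zero⟩
      mul_mem' := by
        rintro _ _ ⟨a, ha, rfl⟩ ⟨b, hb, rfl⟩
        exact ⟨a + b, E.add_mem ha hb, NormedSpace.exp_add⟩ }
  have hle : Subalgebra.toSubmodule (Algebra.adjoin ℝ (S : Set C(X, ℝ))) ≤ V := by
    rw [Algebra.adjoin_eq_span, Submonoid.closure_eq, Submodule.span_le]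
    rintro _ ⟨g, hg, rfl⟩
    exact hexp g hg
  have hsep : (Algebra.adjoin ℝ (S : Set C(X, ℝ))).SeparatesPoints := by
    intro x y hxy
    obtain ⟨g, hg, hne⟩ := hE x y hxy
    refine ⟨_, ⟨NormedSpace.exp g, Algebra.subset_adjoin ⟨g, hg, rfl⟩, rfl⟩, ?_⟩
    have hev : ∀ z, (NormedSpace.exp g) z = Real.exp (g z) := by
      intro z
      rw [Real.exp_eq_exp_ℝ]
      exact NormedSpace.map_exp (ContinuousMap.evalAlgHom ℝ ℝ z)
        (continuous_eval_const z) g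
    change (NormedSpace.exp g) x ≠ (NormedSpace.exp g) y
    rw [hev, hev]
    exact fun h => hne (Real.exp_injective h)
  have htop := ContinuousMap.subalgebra_topologicalClosure_eq_top_of_separatesPoints _ hsep
  refine eq_top_iff.2 fun f _ => ?_
  have hf : f ∈ (Algebra.adjoin ℝ (S : Set C(X, ℝ))).topologicalClosure := htop ▸ trivial
  exact closure_minimal (fun a ha => hle ha) hV hf

end

theorem exists_ridge_sum_near {L : ℕ} {s : Set (Fin L → ℝ)} (hs : IsCompact s)
    {Φ : (Fin L → ℝ) → Fin L → ℝ} (hΦ : Continuous Φ) (hΦs : Set.InjOn Φ s)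
    {K : NNReal} {σ : ℝ → ℝ} (hσ : LipschitzWith K σ)
    (hσ' : ¬ ∃ q : Polynomial ℝ, ∀ x, σ x = q.eval x)
    {G : (Fin L → ℝ) → ℝ} (hG : ContinuousOn G s) {ε : ℝ} (hε : 0 < ε) :
    ∃ (m : ℕ) (w : Fin (m + 1) → Fin L → ℝ) (N θ : Fin (m + 1) → ℝ),
      ∀ u ∈ s, |∑ c, N c * σ (∑ k, w c k * Φ u k + θ c) - G u| ≤ ε := by
  have : CompactSpace s := isCompact_iff_compactSpace.1 hs
  have hσc := hσ.continuous
  let lin : (Fin L → ℝ) →ₗ[ℝ] C(s, ℝ) :=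
    { toFun := fun w => ⟨fun u => ∑ k, w k * Φ u k, by fun_prop⟩
      map_add' := fun w w' => by ext u; simp [add_mul, Finset.sum_add_distrib]
      map_smul' := fun a w => by ext u; simp [Finset.mul_sum, mul_assoc] }
  let ridge : (Fin L → ℝ) × ℝ → C(s, ℝ) := fun z =>
    ⟨fun u => σ (lin z.1 u + z.2), by fun_prop⟩
  have htop : (Submodule.span ℝ (Set.range ridge)).topologicalClosure = ⊤ := by
    refine ContinuousMap.eq_top_of_ridge_mem (Submodule.isClosed_topologicalClosure _) hσ hσ'
      (LinearMap.range lin) ?_ ?_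
    · intro x y hxy
      have hne : Φ x ≠ Φ y := fun h => hxy (Subtype.ext (hΦs x.2 y.2 h))
      obtain ⟨k, hk⟩ := Function.ne_iff.1 hne
      refine ⟨_, ⟨Pi.single k 1, rfl⟩, ?_⟩
      have hlin : ∀ z : s, lin (Pi.single k 1) z = Φ z k := fun z => by
        change ∑ i, (Pi.single k 1 : Fin L → ℝ) i * Φ z i = _
        simp [Pi.single_apply]
      rwa [hlin, hlin]
    · rintro _ ⟨w, rfl⟩ θ χ hχ
      refine Submodule.le_topologicalClosure _ (Submodule.subset_span ⟨(w, θ), ?_⟩)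
      ext u
      exact (hχ u).symm
  let G' : C(s, ℝ) := ⟨s.domRestrict G, hG.domRestrict⟩
  have hG' : G' ∈ closure (Submodule.span ℝ (Set.range ridge) : Set C(s, ℝ)) := by
    have : G' ∈ (Submodule.span ℝ (Set.range ridge)).topologicalClosure := htop ▸ trivial
    exact this
  obtain ⟨f, hf, hfG⟩ := Metric.mem_closure_iff.1 hG' ε hε
  obtain ⟨m, c, g, rfl⟩ := Submodule.mem_span_set'.1 hf
  choose z hz using fun i => (g i).2
  -- A null neuron keeps the width positive.
  refine ⟨m, Fin.cons 0 fun i => (z i).1, Fin.cons 0 c, Fin.cons 0 fun i => (z i).2,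
    fun u hu => ?_⟩
  have h1 := (ContinuousMap.dist_apply_le_dist (f := G') (g := ∑ i, c i • (g i : C(s, ℝ)))
    ⟨u, hu⟩).trans hfG.le
  rw [dist_comm, Real.dist_eq] at h1
  refine le_of_eq_of_le (congrArg (fun t => |t - G u|) ?_) h1
  rw [Fin.sum_univ_succ, ContinuousMap.sum_apply]
  simp only [Fin.cons_zero, zero_mul, zero_add, Fin.cons_succ]
  refine Finset.sum_congr rfl fun i _ => ?_
  rw [← hz i]
  rfl

/-! ### Impulse responses of diagonal units -/

/-- The exponents are reversed because an earlier input is propagated through more steps. -/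
theorem exists_vecMul_vandermonde_rev_eq {n : ℕ} {r : Fin n → ℝ} (hr : Function.Injective r)
    (w : Fin n → ℝ) : ∃ z : Fin n → ℝ, ∀ k : Fin n, ∑ l, z l * r l ^ (k.rev : ℕ) = w k := by
  have hdet : IsUnit (Matrix.vandermonde r).det :=
    isUnit_iff_ne_zero.2 (Matrix.det_vandermonde_ne_zero_iff.2 hr)
  refine ⟨Matrix.vecMul (fun k => w k.rev) (Matrix.vandermonde r)⁻¹, fun k => ?_⟩
  have h := congrFun (Matrix.vecMul_vecMul (fun k : Fin n => w k.rev) (Matrix.vandermonde r)⁻¹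
    (Matrix.vandermonde r)) k.rev
  rw [Matrix.nonsing_inv_mul _ hdet, Matrix.vecMul_one, Fin.rev_rev] at h
  exact h

namespace B2S6

theorem isCompact_inputs {L : ℕ} (hL : 1 ≤ L) : IsCompact (inputs hL) := by
  have h : inputs hL =
      (Set.univ.pi fun _ => Set.Icc (0 : ℝ) 1) ∩ {u | u (lastPos hL) = 1} := by
    ext u
    simp only [inputs, Set.mem_ofPred_eq, Set.mem_inter_iff, Set.mem_univ_pi]
  rw [h]
  exact (isCompact_univ_pi fun _ => isCompact_Icc).inter_right
    (isClosed_eq (continuous_apply _) continuous_const)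

theorem block_stack {h p : ℕ} (y : Fin h → Fin p → ℝ) (j : Fin h) : block (stack y) j = y j := by
  funext i
  simp [block, stack]

theorem stack_apply {h p : ℕ} (y : Fin h → Fin p → ℝ) (j : Fin h) (i : Fin p) :
    stack y (finProdFinEquiv (j, i)) = y j i := by
  simp [stack]

theorem singleLayer_stack {L h p : ℕ} (hL : 1 ≤ L) (σ : ℝ → ℝ)
    (Γ : (Fin L → Fin (h * p) → ℝ) → (Fin L → Fin (h * p) → ℝ)) (M : Fin (h * p) → ℝ)
    (N θ : Fin h → Fin p → ℝ) (u : Fin L → ℝ) :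
    singleLayer hL σ Γ M (stack N) (stack θ) u = ∑ j, ∑ i, N j i *
      σ (Γ (fun k => u k • M) (lastPos hL) (finProdFinEquiv (j, i)) + θ j i) := by
  rw [singleLayer, ← finProdFinEquiv.sum_comp, Fintype.sum_prod_type]
  simp only [stack_apply]

namespace Params

variable {h p n : ℕ}

theorem Abar_of_diagonal {P : Params h p n} {a : Fin n → ℝ} (hA : P.A = Matrix.diagonal a) (δ : ℝ) :
    P.Abar δ = Matrix.diagonal fun l => Real.exp (δ * a l) := by
  rw [Abar, hA, ← Matrix.diagonal_smul, Matrix.exp_diagonal]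
  congr 1
  funext l
  rw [Pi.coe_exp, Real.exp_eq_exp_ℝ]
  rfl

theorem Bbar_of_diagonal {P : Params h p n} {a : Fin n → ℝ} (hA : P.A = Matrix.diagonal a)
    (ha : ∀ l, a l ≠ 0) (δ : ℝ) (j : Fin h) (i : Fin p) (v : Fin p → ℝ) (l : Fin n) :
    P.Bbar δ j i v l =
      (a l)⁻¹ * (Real.exp (δ * a l) - 1) * ((P.Bweight j).mulVec v + P.Bbias j i) l := by
  have hinv : (Matrix.diagonal a)⁻¹ = Matrix.diagonal fun l => (a l)⁻¹ := by
    refine Matrix.inv_eq_right_inv ?_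
    rw [Matrix.diagonal_mul_diagonal, ← Matrix.diagonal_one]
    congr 1
    funext l
    exact mul_inv_cancel₀ (ha l)
  rw [Bbar, Abar_of_diagonal hA, hA, hinv, ← Matrix.diagonal_one, Matrix.diagonal_sub,
    Matrix.diagonal_mul_diagonal, Matrix.mulVec_diagonal]

/-- Once the increments split as `v k * β l`, the recursion is a discrete convolution; `v` will be
`u ^ 2` or `u`. -/
theorem state_of_diagonal {P : Params h p n} {a : Fin n → ℝ} (hA : P.A = Matrix.diagonal a)
    {L : ℕ} (δ : ℝ) (U : Fin L → Fin (h * p) → ℝ) (j : Fin h) (i : Fin p)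
    (v : Fin L → ℝ) (β : Fin n → ℝ)
    (hinc : ∀ k l, block (U k) j i * P.Bbar δ j i (block (U k) j) l = v k * β l)
    (k : ℕ) (hk : k ≤ L) (l : Fin n) :
    P.state (fun _ _ _ => δ) U j i k hk l =
      β l * ∑ s : Fin k, Real.exp (δ * a l) ^ (s.rev : ℕ) * v (Fin.castLE hk s) := by
  induction k with
  | zero => simp [state]
  | succ k ih =>
    rw [state, Pi.add_apply, Abar_of_diagonal hA, Matrix.mulVec_diagonal, ih, Pi.smul_apply,
      smul_eq_mul, hinc, Fin.sum_univ_castSucc, mul_add]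
    congr 1
    · rw [mul_left_comm, Finset.mul_sum]
      congr 1
      refine Finset.sum_congr rfl fun s _ => ?_
      rw [Fin.rev_castSucc, Fin.val_succ, pow_succ', mul_assoc]
      rfl
    · rw [Fin.rev_last, Fin.val_zero, pow_zero, one_mul, mul_comm]
      rfl

theorem unit_last_of_diagonal {L : ℕ} (hL : 1 ≤ L) {P : Params h p n} {a : Fin n → ℝ}
    (hA : P.A = Matrix.diagonal a) (δ : ℝ) (U : Fin L → Fin (h * p) → ℝ) (j : Fin h) (i : Fin p)
    (v : Fin L → ℝ) (β : Fin n → ℝ)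
    (hinc : ∀ k l, block (U k) j i * P.Bbar δ j i (block (U k) j) l = v k * β l)
    (hC : P.Cbar j (block (U (lastPos hL)) j) = 1) :
    P.unit (fun _ _ _ => δ) U (lastPos hL) (finProdFinEquiv (j, i)) =
      ∑ k, (∑ l, β l * Real.exp (δ * a l) ^ (k.rev : ℕ)) * v k := by
  obtain ⟨L, rfl⟩ := Nat.exists_eq_add_of_le' hL
  rw [unit, stack_apply, hC, one_dotProduct]
  simp only [state_of_diagonal hA δ U j i v β hinc, Finset.mul_sum, Finset.sum_mul]
  rw [Finset.sum_comm]
  refine Finset.sum_congr rfl fun k _ => Finset.sum_congr rfl fun l _ => ?_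
  exact (mul_assoc _ _ _).symm

end Params

/-- Distinct positive eigenvalues of the state matrix. -/
def succEigenvalues (n : ℕ) (l : Fin n) : ℝ := (l : ℝ) + 1

theorem succEigenvalues_pos {n : ℕ} (l : Fin n) : 0 < succEigenvalues n l := by
  unfold succEigenvalues
  positivity

theorem isUnit_diagonal_succEigenvalues (n : ℕ) :
    IsUnit (Matrix.diagonal (succEigenvalues n)) := by
  rw [Matrix.isUnit_diagonal, Pi.isUnit_iff]
  exact fun l => isUnit_iff_ne_zero.2 (succEigenvalues_pos l).ne'

/-- Input weights that realize prescribed impulse responses at the last position. -/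
theorem exists_input_weights {δ : ℝ} (hδ : 0 < δ) {L : ℕ} (w : Fin L → ℝ) :
    ∃ b : Fin L → ℝ, ∀ k : Fin L, ∑ l, ((succEigenvalues L l)⁻¹ *
      (Real.exp (δ * succEigenvalues L l) - 1) * b l) *
        Real.exp (δ * succEigenvalues L l) ^ (k.rev : ℕ) = w k := by
  have hinj : Function.Injective fun l : Fin L => Real.exp (δ * succEigenvalues L l) := by
    intro l l' h
    have h1 := mul_left_cancel₀ hδ.ne' (Real.exp_injective h)
    exact Fin.ext (Nat.cast_injective (R := ℝ) (add_right_cancel h1))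
  obtain ⟨z, hz⟩ := exists_vecMul_vandermonde_rev_eq hinj w
  -- The divisor is the zero-order hold factor, nonzero since `δ` and the eigenvalues are positive.
  refine ⟨fun l => z l / ((succEigenvalues L l)⁻¹ *
    (Real.exp (δ * succEigenvalues L l) - 1)), fun k => ?_⟩
  rw [← hz k]
  refine Finset.sum_congr rfl fun l _ => ?_
  have h1 := succEigenvalues_pos l
  have h2 : 1 < Real.exp (δ * succEigenvalues L l) := Real.one_lt_exp_iff.2 (mul_pos hδ h1)
  rw [mul_div_cancel₀]
  exact mul_ne_zero (inv_ne_zero h1.ne') (sub_ne_zero.2 h2.ne')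

end B2S6

/-! ### The two constructions -/

open B2S6 in
theorem mainTheorem4 (Δ : ℝ) (hΔ : 0 < Δ) (L : ℕ) (hL : 1 ≤ L)
    (σ : ℝ → ℝ) (hσ : ∃ K : NNReal, LipschitzWith K σ)
    (hσ' : ¬ ∃ q : Polynomial ℝ, ∀ x, σ x = q.eval x)
    (G : (Fin L → ℝ) → ℝ) (hG : ContinuousOn G (B2S6.inputs hL)) (ε : ℝ) (hε : 0 < ε) :
    (∃ h p n : ℕ, 1 ≤ h ∧ 1 ≤ p ∧ 1 ≤ n ∧
      ∃ (M N θ : Fin (h * p) → ℝ) (P : B2S6.Params h p n),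
        P.A.IsDiag ∧ IsUnit P.A ∧ (∀ j i, P.Bbias j i = 0) ∧
        ∀ u ∈ B2S6.inputs hL,
          |B2S6.singleLayer hL σ (P.unit fun _ _ _ => Δ) M N θ u - G u| ≤ ε) ∧
    (∃ d n : ℕ, 1 ≤ d ∧ 1 ≤ n ∧
      ∃ (M N θ : Fin (1 * d) → ℝ) (P : B2S6.Params 1 d n),
        P.A.IsDiag ∧ IsUnit P.A ∧
        ∀ u ∈ B2S6.inputs hL,
          |B2S6.singleLayer hL σ (P.unit fun _ _ _ => Δ) M N θ u - G u| ≤ ε) := by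
  obtain ⟨K, hK⟩ := hσ
  constructor
  · have hsq : Set.InjOn (fun (u : Fin L → ℝ) k => u k ^ 2) (inputs hL) := by
      intro u hu u' hu' h
      funext k
      exact (sq_eq_sq₀ (hu.1 k).1 (hu'.1 k).1).1 (congrFun h k)
    obtain ⟨m, w, N, θ, happ⟩ := exists_ridge_sum_near (isCompact_inputs hL)
      (by fun_prop) hsq hK hσ' hG hε
    choose b hb using fun c => exists_input_weights hΔ (w c)
    -- One scalar block per neuron: weight times input times input gives the square, and the readout
    -- row is `u_L = 1` throughout.
    let P : Params (m + 1) 1 L :=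
      { A := Matrix.diagonal (succEigenvalues L)
        Bweight := fun j => Matrix.of fun l _ => b j l
        Bbias := 0
        C := fun _ => Matrix.of fun _ _ => 1 }
    refine ⟨m + 1, 1, L, by omega, le_rfl, hL, stack 1, stack fun j _ => N j, stack fun j _ => θ j,
      P, Matrix.isDiag_diagonal _, isUnit_diagonal_succEigenvalues L, fun _ _ => rfl,
      fun u hu => ?_⟩
    have hblock : ∀ k j, block (u k • stack (1 : Fin (m + 1) → Fin 1 → ℝ)) j = fun _ => u k := by
      intro k j
      funext i
      change u k * block (stack 1) j i = u k
      rw [block_stack]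
      exact mul_one _
    rw [singleLayer_stack]
    convert happ u hu using 3
    refine Finset.sum_congr rfl fun j _ => ?_
    rw [Fin.sum_univ_one, Params.unit_last_of_diagonal hL (P := P) (a := succEigenvalues L) rfl Δ _ j 0
      (fun k => u k ^ 2) (fun l => (succEigenvalues L l)⁻¹ *
      (Real.exp (Δ * succEigenvalues L l) - 1) * b j l)]
    · simp only [hb]
    · intro k l
      rw [Params.Bbar_of_diagonal (a := succEigenvalues L) rfl fun l => (succEigenvalues_pos l).ne',
        hblock]
      simp [P, Matrix.mulVec, dotProduct]
      ring
    · rw [hblock, hu.2]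
      funext l
      simp [P, Params.Cbar, Matrix.vecMul, dotProduct]
  · obtain ⟨m, w, N, θ, happ⟩ := exists_ridge_sum_near (isCompact_inputs hL)
      continuous_id (Set.injOn_id _) hK hσ' hG hε
    choose b hb using fun c => exists_input_weights hΔ (w c)
    -- One channel per neuron, told apart by its bias alone. All channels share `C`, whose single
    -- nonzero row makes the readout all ones at the last position.
    let P : Params 1 (m + 1) L :=
      { A := Matrix.diagonal (succEigenvalues L)
        Bweight := 0
        Bbias := fun _ => b
        C := fun _ => Matrix.of fun i _ => if i = 0 then 1 else 0 }
    refine ⟨m + 1, L, by omega, hL, stack 1, stack fun _ => N, stack fun _ => θ,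
      P, Matrix.isDiag_diagonal _, isUnit_diagonal_succEigenvalues L, fun u hu => ?_⟩
    have hblock : ∀ k j, block (u k • stack (1 : Fin 1 → Fin (m + 1) → ℝ)) j = fun _ => u k := by
      intro k j
      funext i
      change u k * block (stack 1) j i = u k
      rw [block_stack]
      exact mul_one _
    rw [singleLayer_stack, Fin.sum_univ_one]
    convert happ u hu using 3
    refine Finset.sum_congr rfl fun i _ => ?_
    rw [Params.unit_last_of_diagonal hL (P := P) (a := succEigenvalues L) rfl Δ _ 0 i
      u (fun l => (succEigenvalues L l)⁻¹ *
      (Real.exp (Δ * succEigenvalues L l) - 1) * b i l)]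
    · simp only [hb, id]
    · intro k l
      rw [Params.Bbar_of_diagonal (a := succEigenvalues L) rfl fun l => (succEigenvalues_pos l).ne',
        hblock]
      simp [P]
    · rw [hblock, hu.2]
      funext l
      simp [P, Params.Cbar, Matrix.vecMul, dotProduct]
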